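/- \textbf{Proposition 3.} There exists a bipartite quantum state $\rho$ on a finite-dimensional space $\mathcal H_A\otimes\mathcal H_B$ whose catalytic exact LOCC entanglement cost is strictly lower than its exact LOCC entanglement cost: $$E_{c,c}^{0}(\rho) < E_c^{0}(\rho),$$ both costs being finite. Here LOCC operations are taken with respect to the splitting of all systems between Alice and Bob (finitely many rounds of local measurements with finitely many outcomes and classical communication), $\Phi=|\Phi\rangle\langle\Phi|$ with $|\Phi\rangle=\frac{1}{\sqrt2}(|00\rangle+|11\rangle)$ is a Bell pair, and the costs are defined as follows. $E_c^{0}(\rho)$ is the infimum of all real $r$ such that for every $\delta>0$ there are integers $m\ge 0$, $n\ge 1$ and an LOCC operation $\Lambda$ with $$\Lambda(\Phi^{\otimes m})=\rho^{\otimes n},\qquad \frac mn\le r+\delta .$$ $E_{c,c}^{0}(\rho)$ is the infimum of all real $r$ such that for every $\delta>0$ there are integers $m\ge 0$, $n\ge 1$, a finite-dimensional bipartite state $\tau_C$ (the catalyst, shared by Alice and Bob) and an LOCC operation $\Lambda$ acting on system $S$ and catalyst $C$ with $$\operatorname{Tr}_C\Lambda(\Phi^{\otimes m}_S\otimes\tau_C)=\rho^{\otimes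 n}_S,\qquad \operatorname{Tr}_S\Lambda(\Phi^{\otimes m}_S\otimes\tau_C)=\tau_C,\qquad \frac mn\le r+\delta .$$ -/

import Mathlib

open scoped Kronecker ComplexOrder

namespace EntCost

/-- A quantum state on the finite-dimensional Hilbert space `ℂ^S`, as a density matrix in the
computational basis. -/
def IsState {S : Type} [Fintype S] (ρ : Matrix S S ℂ) : Prop :=
  ρ.PosSemidef ∧ ρ.trace = 1

/-- The map `X ↦ K X K†`. -/
def conjBy {S T : Type} [Fintype S] (K : Matrix T S ℂ) :
    Matrix S S ℂ →ₗ[ℂ] Matrix T T ℂ where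
  toFun X := K * X * K.conjTranspose
  map_add' X Y := by rw [Matrix.mul_add, Matrix.add_mul]
  map_smul' c X := by simp

/-- `IsLOCC Λ`: the linear map `Λ`, from operators on `ℂ^A ⊗ ℂ^B` (Alice holds `A`, Bob holds `B`)
to operators on `ℂ^A' ⊗ ℂ^B'`, is implemented by an LOCC protocol, that is, by a protocol with
finitely many rounds. In each round one party performs a local measurement with finitely many
outcomes, given by Kraus operators `K i` with `∑ i, K i† K i = 1`; the post-measurement local system
`X i` is arbitrary, so that local ancillas, local channels, partial traces and local randomness
are included. The outcome `i` is communicated to the other party, and the rest of the protocol may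
depend on it. At the end the record of all outcomes is forgotten. -/
inductive IsLOCC {A' B' : Type} [Fintype A'] [DecidableEq A'] [Fintype B'] [DecidableEq B'] :
    ∀ {A B : Type} [Fintype A] [DecidableEq A] [Fintype B] [DecidableEq B],
      (Matrix (A × B) (A × B) ℂ →ₗ[ℂ] Matrix (A' × B') (A' × B') ℂ) → Prop
  | done : IsLOCC (A := A') (B := B') LinearMap.id
  | alice {A B : Type} [Fintype A] [DecidableEq A] [Fintype B] [DecidableEq B]
      {ι : Type} [Fintype ι] (X : ι → Type) [∀ i, Fintype (X i)] [∀ i, DecidableEq (X i)]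
      (K : ∀ i, Matrix (X i) A ℂ) (hK : ∑ i, (K i).conjTranspose * K i = 1)
      (Λ : ∀ i, Matrix (X i × B) (X i × B) ℂ →ₗ[ℂ] Matrix (A' × B') (A' × B') ℂ)
      (hΛ : ∀ i, IsLOCC (Λ i)) :
      IsLOCC (A := A) (B := B) (∑ i, Λ i ∘ₗ conjBy (K i ⊗ₖ (1 : Matrix B B ℂ)))
  | bob {A B : Type} [Fintype A] [DecidableEq A] [Fintype B] [DecidableEq B]
      {ι : Type} [Fintype ι] (X : ι → Type) [∀ i, Fintype (X i)] [∀ i, DecidableEq (X i)]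
      (K : ∀ i, Matrix (X i) B ℂ) (hK : ∑ i, (K i).conjTranspose * K i = 1)
      (Λ : ∀ i, Matrix (A × X i) (A × X i) ℂ →ₗ[ℂ] Matrix (A' × B') (A' × B') ℂ)
      (hΛ : ∀ i, IsLOCC (Λ i)) :
      IsLOCC (A := A) (B := B) (∑ i, Λ i ∘ₗ conjBy ((1 : Matrix A A ℂ) ⊗ₖ K i))

/-- The vector `(|00⟩ + |11⟩) / √2`. -/
noncomputable def bellKet : Fin 2 × Fin 2 → ℂ :=
  fun p => if p.1 = p.2 then ((1 / Real.sqrt 2 : ℝ) : ℂ) else 0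

/-- The Bell pair `Φ`, as a density matrix. -/
noncomputable def bell : Matrix (Fin 2 × Fin 2) (Fin 2 × Fin 2) ℂ :=
  Matrix.vecMulVec bellKet (star bellKet)

/-- `ρ^{⊗ n}` as a bipartite operator: Alice holds the `n` copies of `A`, Bob those of `B`. -/
def copies {A B : Type} (ρ : Matrix (A × B) (A × B) ℂ) (n : ℕ) :
    Matrix ((Fin n → A) × (Fin n → B)) ((Fin n → A) × (Fin n → B)) ℂ :=
  fun x y => ∏ i, ρ (x.1 i, x.2 i) (y.1 i, y.2 i)

/-- `ρ ⊗ τ` as a bipartite operator: Alice holds `A` and `C`, Bob holds `B` and `D`. -/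
def bipTensor {A B C D : Type} (ρ : Matrix (A × B) (A × B) ℂ) (τ : Matrix (C × D) (C × D) ℂ) :
    Matrix ((A × C) × (B × D)) ((A × C) × (B × D)) ℂ :=
  fun x y => ρ (x.1.1, x.2.1) (y.1.1, y.2.1) * τ (x.1.2, x.2.2) (y.1.2, y.2.2)

/-- Partial trace over the catalyst (Alice's part `C` and Bob's part `D`). -/
def trCatalyst {A B C D : Type} [Fintype C] [Fintype D]
    (M : Matrix ((A × C) × (B × D)) ((A × C) × (B × D)) ℂ) : Matrix (A × B) (A × B) ℂ :=
  fun x y => ∑ c : C, ∑ d : D, M ((x.1, c), (x.2, d)) ((y.1, c), (y.2, d))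

/-- Partial trace over the system (Alice's part `A` and Bob's part `B`). -/
def trSystem {A B C D : Type} [Fintype A] [Fintype B]
    (M : Matrix ((A × C) × (B × D)) ((A × C) × (B × D)) ℂ) : Matrix (C × D) (C × D) ℂ :=
  fun x y => ∑ a : A, ∑ b : B, M ((a, x.1), (b, x.2)) ((a, y.1), (b, y.2))

section Cost

variable {A B : Type} [Fintype A] [DecidableEq A] [Fintype B] [DecidableEq B]

/-- The achievable rates for preparing `ρ` exactly from Bell pairs by LOCC. -/
def exactRates (ρ : Matrix (A × B) (A × B) ℂ) : Set ℝ :=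
  {r | ∀ δ : ℝ, 0 < δ → ∃ (m n : ℕ)
    (Λ : Matrix ((Fin m → Fin 2) × (Fin m → Fin 2)) ((Fin m → Fin 2) × (Fin m → Fin 2)) ℂ →ₗ[ℂ]
      Matrix ((Fin n → A) × (Fin n → B)) ((Fin n → A) × (Fin n → B)) ℂ),
    0 < n ∧ IsLOCC Λ ∧ Λ (copies bell m) = copies ρ n ∧ (m : ℝ) / (n : ℝ) ≤ r + δ}

/-- The exact LOCC entanglement cost. -/
noncomputable def exactCost (ρ : Matrix (A × B) (A × B) ℂ) : ℝ :=
  sInf (exactRates ρ)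

/-- The catalytically achievable rates. The catalyst `τ` is a bipartite state shared by Alice
and Bob; in the final state it may be correlated with the system. -/
def catalyticRates (ρ : Matrix (A × B) (A × B) ℂ) : Set ℝ :=
  {r | ∀ δ : ℝ, 0 < δ → ∃ (m n c d : ℕ) (τ : Matrix (Fin c × Fin d) (Fin c × Fin d) ℂ)
    (Λ : Matrix (((Fin m → Fin 2) × Fin c) × ((Fin m → Fin 2) × Fin d))
        (((Fin m → Fin 2) × Fin c) × ((Fin m → Fin 2) × Fin d)) ℂ →ₗ[ℂ]
      Matrix (((Fin n → A) × Fin c) × ((Fin n → B) × Fin d))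
        (((Fin n → A) × Fin c) × ((Fin n → B) × Fin d)) ℂ),
    0 < n ∧ IsState τ ∧ IsLOCC Λ ∧
    trCatalyst (Λ (bipTensor (copies bell m) τ)) = copies ρ n ∧
    trSystem (Λ (bipTensor (copies bell m) τ)) = τ ∧
    (m : ℝ) / (n : ℝ) ≤ r + δ}

/-- The catalytic exact LOCC entanglement cost. -/
noncomputable def catalyticExactCost (ρ : Matrix (A × B) (A × B) ℂ) : ℝ :=
  sInf (catalyticRates ρ)

end Cost

end EntCost

/-!
The separating state is `flagged 4`, the even mixture of a product state `|4⟩|4⟩` and a maximally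
entangled state of Schmidt rank `4`, which the parties can tell apart locally. A maximally
entangled state of rank `4` amounts to two Bell pairs, so on average one copy contains one Bell
pair, and a suitable catalyst makes this average sufficient; exact preparation without a catalyst
has to pay for the worst case.

* Lower bound for the exact cost. LOCC operations do not increase the Schmidt number
  (`IsLOCC.schmidtNumberLE`), and `m` Bell pairs have Schmidt number `2 ^ m`. The projection of `n`
  copies of `flagged 4` onto the levels below `4` is a maximally entangled pure state of rank
  `4 ^ n`. As pure states are extremal, every decomposition of the copies contains a vector of at
  least this Schmidt rank (`SchmidtNumberLE.card_le`), so that `2 * n ≤ m`.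
* Upper bound for the catalytic cost. The catalyst is `flagged 2`, which holds one Bell pair with
  probability one half. One more Bell pair is supplied. If the catalyst was empty, the supplied
  pair is stored in it and the system receives the flag; if it held a pair, both pairs go to the
  system and the catalyst is emptied. This is a local relabelling of basis states, `swapMap`, and
  both marginals come out as required (`one_mem_catalyticRates`), although system and catalyst end
  up correlated.
-/

namespace EntCost

open Matrix

/-! ### Pure states and local operators -/

/-- The rank-one operator `|v⟩⟨v|`, where `V` is the coefficient matrix of
`v = ∑ a b, V a b |a⟩|b⟩`. The Schmidt rank of `v` is then `V.rank`. -/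
def ketBra {A B : Type} (V : Matrix A B ℂ) : Matrix (A × B) (A × B) ℂ :=
  vecMulVec (vec Vᵀ) (star (vec Vᵀ))

theorem ketBra_apply {A B : Type} (V : Matrix A B ℂ) (x y : A × B) :
    ketBra V x y = V x.1 x.2 * star (V y.1 y.2) := rfl

theorem ketBra_smul {A B : Type} (c : ℂ) (V : Matrix A B ℂ) :
    ketBra (c • V) = (c * star c) • ketBra V := by
  ext x y
  simp only [ketBra_apply, Matrix.smul_apply, smul_eq_mul, star_mul']
  ring

theorem ketBra_posSemidef {A B : Type} [Fintype A] [Fintype B] (V : Matrix A B ℂ) :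
    (ketBra V).PosSemidef :=
  posSemidef_vecMulVec_self_star _

theorem conjBy_apply {S T : Type} [Fintype S] (K : Matrix T S ℂ) (X : Matrix S S ℂ) :
    conjBy K X = K * X * Kᴴ := rfl

theorem conjBy_comp {S T U : Type} [Fintype S] [Fintype T] (K : Matrix U T ℂ)
    (L : Matrix T S ℂ) : conjBy K ∘ₗ conjBy L = conjBy (K * L) := by
  ext1 X
  simp [conjBy_apply, conjTranspose_mul, Matrix.mul_assoc]

theorem conjBy_one {S : Type} [Fintype S] [DecidableEq S] :
    conjBy (1 : Matrix S S ℂ) = LinearMap.id := by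
  ext1 X
  simp [conjBy_apply]

theorem conjBy_smul {S T : Type} [Fintype S] (c : ℂ) (K : Matrix T S ℂ) :
    conjBy (c • K) = (c * star c) • conjBy K := by
  ext1 X
  simp [conjBy_apply, conjTranspose_smul, smul_smul, mul_comm]

theorem conjBy_kronecker_ketBra {A B A' B' : Type} [Fintype A] [Fintype B]
    (K : Matrix A' A ℂ) (L : Matrix B' B ℂ) (V : Matrix A B ℂ) :
    conjBy (K ⊗ₖ L) (ketBra V) = ketBra (K * V * Lᵀ) := by
  have h : (K ⊗ₖ L) *ᵥ vec Vᵀ = vec (K * V * Lᵀ)ᵀ := by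
    rw [kronecker_mulVec_vec, transpose_mul, transpose_mul, transpose_transpose, Matrix.mul_assoc]
  rw [conjBy_apply, ketBra, mul_vecMulVec, vecMulVec_mul, ← star_mulVec, h, ketBra]

/-- The rank-one operator of the vector `∑ a, v a |a⟩|a⟩` in Schmidt form. -/
def schmidt {A : Type} [DecidableEq A] (v : A → ℂ) : Matrix (A × A) (A × A) ℂ :=
  ketBra (diagonal v)

theorem schmidt_apply {A : Type} [DecidableEq A] (v : A → ℂ) (x y : A × A) :
    schmidt v x y =
      (if x.1 = x.2 then v x.1 else 0) * star (if y.1 = y.2 then v y.1 else 0) := rfl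

theorem trace_schmidt {A : Type} [Fintype A] [DecidableEq A] (v : A → ℂ) :
    (schmidt v).trace = ∑ a, v a * star (v a) := by
  simp [Matrix.trace, schmidt_apply, Fintype.sum_prod_type]

theorem single_eq_schmidt {A : Type} [DecidableEq A] (a₀ : A) :
    single (a₀, a₀) (a₀, a₀) (1 : ℂ) = schmidt fun a => if a = a₀ then 1 else 0 := by
  ext ⟨a, b⟩ ⟨a', b'⟩
  simp only [single_apply, schmidt_apply, Prod.mk.injEq]
  rw [← ite_and, ← ite_and, apply_ite star, star_one, star_zero, ite_zero_mul_ite_zero, one_mul]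
  exact if_congr (by grind) rfl rfl

/-- The isometry `|a⟩ ↦ |f a⟩` given by an injection `f` of basis states. -/
def relabel {A A' : Type} [DecidableEq A'] (f : A → A') : Matrix A' A ℂ :=
  of fun t a => if t = f a then 1 else 0

theorem relabel_isometry {A A' : Type} [Fintype A'] [DecidableEq A] [DecidableEq A']
    {f : A → A'} (hf : f.Injective) : (relabel f)ᴴ * relabel f = 1 := by
  ext a b
  simp [relabel, Matrix.mul_apply, one_apply, hf.eq_iff, apply_ite, eq_comm]

theorem conjBy_relabel_schmidt {A A' : Type} [Fintype A] [DecidableEq A] [DecidableEq A']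
    {f : A → A'} (hf : f.Injective) {v : A → ℂ} {w : A' → ℂ} (hv : ∀ a, w (f a) = v a)
    (hw : ∀ t, w t ≠ 0 → ∃ a, f a = t) :
    conjBy (relabel f ⊗ₖ relabel f) (schmidt v) = schmidt w := by
  rw [schmidt, conjBy_kronecker_ketBra, schmidt]
  congr 1
  ext s t
  rw [Matrix.mul_apply]
  simp only [mul_diagonal, relabel, transpose_apply, of_apply, diagonal_apply]
  by_cases hs : ∃ a, f a = s
  · obtain ⟨a, rfl⟩ := hs
    rw [Finset.sum_eq_single a (fun b _ hb => by simp [hf.eq_iff, hb.symm]) (by simp)]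
    simp [hv, eq_comm]
  · have h0 : w s = 0 := by
      by_contra h
      exact hs (hw s h)
    have h1 : ∀ a, s ≠ f a := fun a h => hs ⟨a, h.symm⟩
    simp [h0, h1]

/-! ### Some LOCC operations -/

section LOCC

variable {A B A' B' : Type} [Fintype A] [DecidableEq A] [Fintype B] [DecidableEq B]
  [Fintype A'] [DecidableEq A'] [Fintype B'] [DecidableEq B']

theorem isLOCC_local_kraus {ι κ : Type} [Fintype ι] [Fintype κ] (K : ι → Matrix A' A ℂ)
    (L : κ → Matrix B' B ℂ) (hK : ∑ i, (K i)ᴴ * K i = 1) (hL : ∑ j, (L j)ᴴ * L j = 1) :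
    IsLOCC (∑ i, ∑ j, conjBy (K i ⊗ₖ L j)) := by
  have h := IsLOCC.alice (B := B) (fun _ => A') K hK _
    fun _ => IsLOCC.bob (A := A') (fun _ => B') L hL _ fun _ => IsLOCC.done
  convert h using 2 with i
  ext1 X
  simp only [LinearMap.id_comp, LinearMap.comp_apply, LinearMap.sum_apply]
  refine Finset.sum_congr rfl fun j _ => ?_
  rw [← LinearMap.comp_apply, conjBy_comp, ← mul_kronecker_mul, Matrix.one_mul, Matrix.mul_one]

theorem isLOCC_local_isometry {K : Matrix A' A ℂ} {L : Matrix B' B ℂ} (hK : Kᴴ * K = 1)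
    (hL : Lᴴ * L = 1) : IsLOCC (conjBy (K ⊗ₖ L)) := by
  simpa using isLOCC_local_kraus (fun _ : Unit => K) (fun _ : Unit => L) (by simpa) (by simpa)

/-- Both parties can discard their systems and prepare fixed basis states instead. -/
theorem exists_isLOCC_discard (a₀ : A') (b₀ : B') :
    ∃ Λ : Matrix (A × B) (A × B) ℂ →ₗ[ℂ] Matrix (A' × B') (A' × B') ℂ,
      IsLOCC Λ ∧ ∀ X, Λ X = X.trace • single (a₀, b₀) (a₀, b₀) 1 := by
  refine ⟨_, isLOCC_local_kraus (fun a : A => single a₀ a 1) (fun b : B => single b₀ b 1)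
    ?_ ?_, fun X => ?_⟩
  · simp [sum_single_one]
  · simp [sum_single_one]
  · simp only [LinearMap.sum_apply, conjBy_apply, single_kronecker_single,
      conjTranspose_single, single_mul_mul_single, Matrix.trace, Fintype.sum_prod_type,
      Finset.sum_smul, smul_single, diag_apply]
    simp

/-- LOCC operations are closed under mixtures: Alice draws the protocol to be run. -/
theorem isLOCC_mixture {ι : Type} [Fintype ι] (w : ι → ℝ) (hw : ∀ i, 0 ≤ w i)
    (hsum : ∑ i, w i = 1)
    (Λ : ι → Matrix (A × B) (A × B) ℂ →ₗ[ℂ] Matrix (A' × B') (A' × B') ℂ)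
    (hΛ : ∀ i, IsLOCC (Λ i)) : IsLOCC (∑ i, (w i : ℂ) • Λ i) := by
  have hsq : ∀ i, ((√(w i) : ℝ) : ℂ) * ((√(w i) : ℝ) : ℂ) = (w i : ℂ) := fun i => by
    rw [← Complex.ofReal_mul, Real.mul_self_sqrt (hw i)]
  have h := IsLOCC.alice (B := B) (fun _ : ι => A)
    (fun i => ((√(w i) : ℝ) : ℂ) • (1 : Matrix A A ℂ)) ?_ Λ hΛ
  · convert h using 2 with i
    rw [smul_kronecker, one_kronecker_one, conjBy_smul, conjBy_one, Complex.star_def,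
      Complex.conj_ofReal, hsq, LinearMap.comp_smul, LinearMap.comp_id]
  · simp only [conjTranspose_smul, conjTranspose_one, smul_mul_smul_comm, Matrix.mul_one,
      Complex.star_def, Complex.conj_ofReal, hsq, ← Finset.sum_smul]
    rw [← Complex.ofReal_sum, hsum, Complex.ofReal_one, one_smul]

end LOCC

/-! ### Schmidt number -/

/-- The operator `X` is a sum of (unnormalised) pure states of Schmidt rank at most `k`. -/
def SchmidtNumberLE {A B : Type} [Fintype B] (k : ℕ) (X : Matrix (A × B) (A × B) ℂ) : Prop :=
  ∃ (J : Type) (_ : Fintype J) (V : J → Matrix A B ℂ),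
    (∀ j, (V j).rank ≤ k) ∧ X = ∑ j, ketBra (V j)

theorem SchmidtNumberLE.sum {A B : Type} [Fintype B] {k : ℕ} {ι : Type} [Fintype ι]
    {X : ι → Matrix (A × B) (A × B) ℂ} (hX : ∀ i, SchmidtNumberLE k (X i)) :
    SchmidtNumberLE k (∑ i, X i) := by
  choose J _ V hV hXV using hX
  refine ⟨Σ i, J i, inferInstance, fun p => V p.1 p.2, fun p => hV p.1 p.2, ?_⟩
  simp_rw [hXV, Fintype.sum_sigma]

theorem SchmidtNumberLE.conjBy_kronecker {A B A' B' : Type} [Fintype A] [Fintype B] [Fintype B']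
    {k : ℕ} {X : Matrix (A × B) (A × B) ℂ} (hX : SchmidtNumberLE k X) (K : Matrix A' A ℂ)
    (L : Matrix B' B ℂ) : SchmidtNumberLE k (conjBy (K ⊗ₖ L) X) := by
  obtain ⟨J, _, V, hV, rfl⟩ := hX
  refine ⟨J, inferInstance, fun j => K * V j * Lᵀ, fun j => ?_, ?_⟩
  · exact (rank_mul_le_left _ _).trans ((rank_mul_le_right _ _).trans (hV j))
  · simp_rw [map_sum, conjBy_kronecker_ketBra]

theorem IsLOCC.schmidtNumberLE {A' B' : Type} [Fintype A'] [DecidableEq A'] [Fintype B']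
    [DecidableEq B'] {A B : Type} [Fintype A] [DecidableEq A] [Fintype B] [DecidableEq B]
    {Λ : Matrix (A × B) (A × B) ℂ →ₗ[ℂ] Matrix (A' × B') (A' × B') ℂ} (hΛ : IsLOCC Λ)
    {k : ℕ} {X : Matrix (A × B) (A × B) ℂ} (hX : SchmidtNumberLE k X) :
    SchmidtNumberLE k (Λ X) := by
  induction hΛ with
  | done => exact hX
  | alice X K hK Λ hΛ ih =>
    rw [LinearMap.sum_apply]
    exact .sum fun i => ih i (hX.conjBy_kronecker _ _)
  | bob X K hK Λ hΛ ih =>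
    rw [LinearMap.sum_apply]
    exact .sum fun i => ih i (hX.conjBy_kronecker _ _)

/-- A pure state is extremal: if an operator of Schmidt number at most `k` has a maximally
entangled corner of dimension `|T|`, then one of the vectors in its decomposition restricts to a
nonzero multiple of the maximally entangled vector, whose Schmidt rank is `|T|`. -/
theorem SchmidtNumberLE.card_le {A T : Type} [Fintype A] [Fintype T] [DecidableEq T] [Nonempty T]
    {k : ℕ} {X : Matrix (A × A) (A × A) ℂ} (hX : SchmidtNumberLE k X) (f : T → A) {c : ℂ}
    (hc : c ≠ 0) (h : ∀ x y : T × T, X (f x.1, f x.2) (f y.1, f y.2) =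
      if x.1 = x.2 ∧ y.1 = y.2 then c else 0) : Fintype.card T ≤ k := by
  obtain ⟨J, _, V, hV, rfl⟩ := hX
  simp only [Matrix.sum_apply, ketBra_apply] at h
  have hdiag : ∀ j, ∀ s t : T, s ≠ t → V j (f s) (f t) = 0 := by
    intro j s t hst
    have h0 := h (s, t) (s, t)
    simp only [hst, false_and, if_false] at h0
    have h1 := (Finset.sum_eq_zero_iff_of_nonneg
      (fun j _ => mul_star_self_nonneg (V j (f s) (f t)))).1 h0 j (Finset.mem_univ j)
    simpa using h1
  have hconst : ∀ j, ∀ s t : T, V j (f s) (f s) = V j (f t) (f t) := by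
    intro j s t
    -- `|ss⟩ - |tt⟩` is orthogonal to the maximally entangled vector
    have h0 : ∑ j, (V j (f s) (f s) - V j (f t) (f t)) *
        star (V j (f s) (f s) - V j (f t) (f t)) = 0 := by
      simp only [star_sub, mul_sub, sub_mul, Finset.sum_sub_distrib]
      rw [h (s, s) (s, s), h (t, t) (s, s), h (s, s) (t, t), h (t, t) (t, t)]
      simp
    have h1 := (Finset.sum_eq_zero_iff_of_nonneg
      (fun j _ => mul_star_self_nonneg (V j (f s) (f s) - V j (f t) (f t)))).1 h0 j
      (Finset.mem_univ j)
    exact sub_eq_zero.1 (CStarRing.mul_star_self_eq_zero_iff _ |>.1 h1)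
  obtain ⟨t⟩ := ‹Nonempty T›
  obtain ⟨j, hj⟩ : ∃ j, V j (f t) (f t) ≠ 0 := by
    by_contra! h0
    have h1 := h (t, t) (t, t)
    simp only [h0, zero_mul, Finset.sum_const_zero, and_self, if_true] at h1
    exact hc h1.symm
  have hsub : (V j).submatrix f f = V j (f t) (f t) • (1 : Matrix T T ℂ) := by
    ext a b
    by_cases hab : a = b
    · subst hab
      simp [hconst j a t]
    · simp [hab, hdiag j a b hab]
  calc Fintype.card T = ((V j).submatrix f f).rank := by
        rw [hsub, rank_smul_of_mem_nonZeroDivisors _ (mem_nonZeroDivisors_of_ne_zero hj),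
          rank_one]
    _ ≤ (V j).rank := rank_submatrix_le _ _ _
    _ ≤ k := hV j

/-! ### Bell pairs and the flagged maximally entangled state -/

theorem copies_bell (m : ℕ) :
    copies bell m = ((1 / 2 : ℂ) ^ m) • schmidt (fun _ : Fin m → Fin 2 => 1) := by
  have hs : ((1 / √2 : ℝ) : ℂ) * star ((1 / √2 : ℝ) : ℂ) = 1 / 2 := by
    rw [Complex.star_def, Complex.conj_ofReal, ← Complex.ofReal_mul, div_mul_div_comm, one_mul,
      Real.mul_self_sqrt (by norm_num)]
    norm_num
  have hb : ∀ x y : Fin 2 × Fin 2,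
      bell x y = if x.1 = x.2 ∧ y.1 = y.2 then (1 / 2 : ℂ) else 0 := by
    intro x y
    rw [bell, vecMulVec_apply, Pi.star_apply, bellKet, bellKet]
    split_ifs <;> simp_all
  ext x y
  simp only [copies, hb, Matrix.smul_apply, schmidt_apply, smul_eq_mul]
  by_cases hx : x.1 = x.2
  · by_cases hy : y.1 = y.2
    · simp [hx, hy]
    · obtain ⟨i, hi⟩ := Function.ne_iff.1 hy
      rw [Finset.prod_eq_zero (Finset.mem_univ i)] <;> simp [hy, hi]
  · obtain ⟨i, hi⟩ := Function.ne_iff.1 hx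
    rw [Finset.prod_eq_zero (Finset.mem_univ i)] <;> simp [hx, hi]

theorem schmidtNumberLE_copies_bell (m : ℕ) : SchmidtNumberLE (2 ^ m) (copies bell m) := by
  refine ⟨Unit, inferInstance,
    fun _ => ((√((1 / 2 : ℝ) ^ m) : ℝ) : ℂ) • diagonal fun _ => 1, fun _ => ?_, ?_⟩
  · exact (rank_le_card_height _).trans_eq (by simp)
  · rw [Fintype.sum_unique, ketBra_smul, copies_bell, schmidt, Complex.star_def,
      Complex.conj_ofReal, ← Complex.ofReal_mul, Real.mul_self_sqrt (by positivity)]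
    norm_num

/-- The even mixture of the product state `|d⟩|d⟩` and of the maximally entangled state on the
first `d` levels. Either party can find out locally which of the two is present. -/
noncomputable def flagged (d : ℕ) :
    Matrix (Fin (d + 1) × Fin (d + 1)) (Fin (d + 1) × Fin (d + 1)) ℂ :=
  (1 / 2 : ℂ) • schmidt (fun a => if a = Fin.last d then 1 else 0) +
    (1 / (2 * d) : ℂ) • schmidt (fun a => if a = Fin.last d then 0 else 1)

theorem sum_ite_last_mul_star (d : ℕ) :
    ∑ a : Fin (d + 1), (if a = Fin.last d then 0 else 1 : ℂ) *
      star (if a = Fin.last d then 0 else 1 : ℂ) = d := by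
  simp [Fin.sum_univ_castSucc, Fin.castSucc_ne_last]

theorem flagged_isState {d : ℕ} (hd : d ≠ 0) : IsState (flagged d) := by
  have hd' : (d : ℂ) ≠ 0 := Nat.cast_ne_zero.2 hd
  refine ⟨.add ((ketBra_posSemidef _).smul ?_) ((ketBra_posSemidef _).smul ?_), ?_⟩
  · simp 
  · positivity
  · simp only [flagged, trace_add, trace_smul, trace_schmidt]
    rw [sum_ite_last_mul_star]
    simp
    field_simp
    norm_num

theorem flagged_castSucc (d : ℕ) (x y : Fin d × Fin d) :
    flagged d (x.1.castSucc, x.2.castSucc) (y.1.castSucc, y.2.castSucc) =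
      if x.1 = x.2 ∧ y.1 = y.2 then (1 / (2 * d) : ℂ) else 0 := by
  simp only [flagged, Matrix.add_apply, Matrix.smul_apply, schmidt_apply, Fin.castSucc_ne_last,
    (Fin.castSucc_injective d).eq_iff]
  split_ifs <;> simp_all

theorem copies_one {A B : Type} (ρ : Matrix (A × B) (A × B) ℂ) :
    copies ρ 1 = fun x y => ρ (x.1 0, x.2 0) (y.1 0, y.2 0) := by
  ext x y
  simp [copies]

theorem copies_one_flagged (d : ℕ) : copies (flagged d) 1 =
    (1 / 2 : ℂ) • schmidt (fun a : Fin 1 → Fin (d + 1) => if a 0 = Fin.last d then 1 else 0) +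
      (1 / (2 * d) : ℂ) •
        schmidt (fun a : Fin 1 → Fin (d + 1) => if a 0 = Fin.last d then 0 else 1) := by
  rw [copies_one]
  ext x y
  have h : ∀ a b : Fin 1 → Fin (d + 1), a = b ↔ a 0 = b 0 := fun a b => by
    rw [funext_iff, Fin.forall_fin_one]
  simp only [flagged, Matrix.add_apply, Matrix.smul_apply, schmidt_apply, h]

/-! ### The exact cost -/

/-- Projecting `n` copies onto the first `d` levels yields a maximally entangled state of Schmidt
rank `d ^ n`. -/
theorem pow_le_of_isLOCC_copies_bell {d m n : ℕ} (hd : d ≠ 0)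
    {Λ : Matrix ((Fin m → Fin 2) × (Fin m → Fin 2)) ((Fin m → Fin 2) × (Fin m → Fin 2)) ℂ →ₗ[ℂ]
      Matrix ((Fin n → Fin (d + 1)) × (Fin n → Fin (d + 1)))
        ((Fin n → Fin (d + 1)) × (Fin n → Fin (d + 1))) ℂ}
    (hΛ : IsLOCC Λ) (h : Λ (copies bell m) = copies (flagged d) n) : d ^ n ≤ 2 ^ m := by
  have hS := hΛ.schmidtNumberLE (schmidtNumberLE_copies_bell m)
  rw [h] at hS
  have : NeZero d := ⟨hd⟩
  have hc := hS.card_le (T := Fin n → Fin d) (fun t i => (t i).castSucc)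
    (c := (1 / (2 * d) : ℂ) ^ n) (pow_ne_zero _ (by simp [hd])) ?_
  · simpa using hc
  · intro x y
    simp only [copies]
    rw [Finset.prod_congr rfl fun i _ => flagged_castSucc d (x.1 i, x.2 i) (y.1 i, y.2 i)]
    by_cases hx : x.1 = x.2
    · by_cases hy : y.1 = y.2
      · simp [hx, hy]
      · obtain ⟨i, hi⟩ := Function.ne_iff.1 hy
        rw [Finset.prod_eq_zero (Finset.mem_univ i)] <;> simp [hy, hi]
    · obtain ⟨i, hi⟩ := Function.ne_iff.1 hx
      rw [Finset.prod_eq_zero (Finset.mem_univ i)] <;> simp [hx, hi]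

theorem two_le_of_mem_exactRates {r : ℝ} (hr : r ∈ exactRates (flagged 4)) : 2 ≤ r := by
  refine le_of_forall_pos_le_add fun δ hδ => ?_
  obtain ⟨m, n, Λ, hn, hΛ, h, hmn⟩ := hr δ hδ
  have h1 : 4 ^ n ≤ 2 ^ m := pow_le_of_isLOCC_copies_bell (by norm_num) hΛ h
  have h2 : 2 * n ≤ m := by
    rw [show 4 = 2 ^ 2 from rfl, ← pow_mul] at h1
    exact (Nat.pow_le_pow_iff_right (by norm_num)).1 h1
  refine le_trans ?_ hmn
  rw [le_div_iff₀ (by exact_mod_cast hn)]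
  exact_mod_cast h2

/-- Two Bell pairs suffice for one copy of `flagged 4`: with probability one half they are kept
as the maximally entangled state, and otherwise they are replaced by the flag. -/
theorem two_mem_exactRates : (2 : ℝ) ∈ exactRates (flagged 4) := by
  intro δ hδ
  obtain ⟨Δ, hΔ, hΔX⟩ := exists_isLOCC_discard (A := Fin 2 → Fin 2) (B := Fin 2 → Fin 2)
    (fun _ : Fin 1 => Fin.last 4) (fun _ : Fin 1 => Fin.last 4)
  let f : (Fin 2 → Fin 2) → (Fin 1 → Fin 5) :=
    fun a _ => (finFunctionFinEquiv a : Fin 4).castSucc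
  have hf : f.Injective := fun a b h =>
    finFunctionFinEquiv.injective (Fin.castSucc_injective 4 (congrFun h 0))
  refine ⟨2, 1, _, one_pos, isLOCC_mixture (fun _ : Fin 2 => 1 / 2) (fun _ => by norm_num)
    (by norm_num) ![Δ, conjBy (relabel f ⊗ₖ relabel f)] ?_, ?_, by norm_num; exact hδ.le⟩
  · rw [Fin.forall_fin_two]
    exact ⟨hΔ, isLOCC_local_isometry (relabel_isometry hf) (relabel_isometry hf)⟩
  · have h1 : conjBy (relabel f ⊗ₖ relabel f) (schmidt fun _ => 1) =
        schmidt fun a : Fin 1 → Fin 5 => if a 0 = Fin.last 4 then 0 else 1 := by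
      refine conjBy_relabel_schmidt hf (fun a => if_neg (Fin.castSucc_ne_last _)) fun t ht => ?_
      have ht0 : t 0 ≠ Fin.last 4 := by simpa using ht
      refine ⟨finFunctionFinEquiv.symm ((t 0).castPred ht0), funext fun i => ?_⟩
      rw [Subsingleton.elim i 0]
      simp [f]
    have h2 : single (fun _ : Fin 1 => Fin.last 4, fun _ : Fin 1 => Fin.last 4)
        (fun _ => Fin.last 4, fun _ => Fin.last 4) (1 : ℂ) =
        schmidt fun a : Fin 1 → Fin 5 => if a 0 = Fin.last 4 then 1 else 0 := by
      rw [single_eq_schmidt]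
      congr! 3 with a
      rw [funext_iff, Fin.forall_fin_one]
    rw [copies_one_flagged, copies_bell]
    simp only [Fin.sum_univ_two, LinearMap.add_apply, LinearMap.smul_apply, cons_val_zero,
      cons_val_one, map_smul, hΔX, h1, h2, trace_schmidt]
    simp [smul_smul]
    norm_num

/-! ### The catalytic cost -/

theorem bipTensor_add {A B C D : Type} (ρ : Matrix (A × B) (A × B) ℂ)
    (σ τ : Matrix (C × D) (C × D) ℂ) :
    bipTensor ρ (σ + τ) = bipTensor ρ σ + bipTensor ρ τ := by
  ext x y
  exact mul_add _ _ _

theorem bipTensor_smul_smul {A B C D : Type} (a b : ℂ) (ρ : Matrix (A × B) (A × B) ℂ)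
    (τ : Matrix (C × D) (C × D) ℂ) :
    bipTensor (a • ρ) (b • τ) = (a * b) • bipTensor ρ τ := by
  ext x y
  exact mul_mul_mul_comm _ _ _ _

theorem trCatalyst_add {A B C D : Type} [Fintype C] [Fintype D]
    (M N : Matrix ((A × C) × (B × D)) ((A × C) × (B × D)) ℂ) :
    trCatalyst (M + N) = trCatalyst M + trCatalyst N := by
  ext x y
  simp [trCatalyst, Finset.sum_add_distrib]

theorem trCatalyst_smul {A B C D : Type} [Fintype C] [Fintype D] (a : ℂ)
    (M : Matrix ((A × C) × (B × D)) ((A × C) × (B × D)) ℂ) :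
    trCatalyst (a • M) = a • trCatalyst M := by
  ext x y
  simp [trCatalyst, Finset.mul_sum]

theorem trSystem_add {A B C D : Type} [Fintype A] [Fintype B]
    (M N : Matrix ((A × C) × (B × D)) ((A × C) × (B × D)) ℂ) :
    trSystem (M + N) = trSystem M + trSystem N := by
  ext x y
  simp [trSystem, Finset.sum_add_distrib]

theorem trSystem_smul {A B C D : Type} [Fintype A] [Fintype B] (a : ℂ)
    (M : Matrix ((A × C) × (B × D)) ((A × C) × (B × D)) ℂ) :
    trSystem (a • M) = a • trSystem M := by
  ext x y
  simp [trSystem, Finset.mul_sum]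

theorem bipTensor_schmidt {A C : Type} [DecidableEq A] [DecidableEq C] (v : A → ℂ) (w : C → ℂ) :
    bipTensor (schmidt v) (schmidt w) = schmidt fun p : A × C => v p.1 * w p.2 := by
  ext ⟨⟨a, c⟩, b, d⟩ ⟨⟨a', c'⟩, b', d'⟩
  simp only [bipTensor, schmidt_apply, Prod.mk.injEq]
  split_ifs <;> simp_all
  ring

theorem trCatalyst_schmidt {A C : Type} [DecidableEq A] [Fintype C] [DecidableEq C]
    (v : A → ℂ) (w : C → ℂ) :
    trCatalyst (schmidt fun p : A × C => v p.1 * w p.2) =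
      (∑ c, w c * star (w c)) • schmidt v := by
  ext ⟨a, b⟩ ⟨a', b'⟩
  simp only [trCatalyst, schmidt_apply, Prod.mk.injEq, Matrix.smul_apply, smul_eq_mul, Finset.sum_mul]
  refine Finset.sum_congr rfl fun c _ => ?_
  rw [Finset.sum_eq_single c]
  · split_ifs <;> simp_all
    ring
  · intro d _ hd
    simp [hd.symm]
  · simp

theorem trSystem_schmidt {A C : Type} [Fintype A] [DecidableEq A] [DecidableEq C]
    (v : A → ℂ) (w : C → ℂ) :
    trSystem (schmidt fun p : A × C => v p.1 * w p.2) =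
      (∑ a, v a * star (v a)) • schmidt w := by
  ext ⟨c, d⟩ ⟨c', d'⟩
  simp only [trSystem, schmidt_apply, Prod.mk.injEq, Matrix.smul_apply, smul_eq_mul, Finset.sum_mul]
  refine Finset.sum_congr rfl fun a _ => ?_
  rw [Finset.sum_eq_single a]
  · split_ifs <;> simp_all
    ring
  · intro b _ hb
    simp [hb.symm]
  · simp

/-- The local basis map of the catalytic protocol, on one half of a Bell pair and the catalyst
`flagged 2`. If the catalyst shows its flag `2`, the Bell pair moves into the catalyst and the
system receives the flag `4`; if the catalyst holds a Bell pair, both pairs move into the system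
and the catalyst receives its flag. -/
def swapMap : (Fin 1 → Fin 2) × Fin 3 → (Fin 1 → Fin 5) × Fin 3 := fun p =>
  ![(fun _ => finProdFinEquiv (p.1 0, (0 : Fin 2)) |>.castLE (by norm_num), 2),
    (fun _ => finProdFinEquiv (p.1 0, (1 : Fin 2)) |>.castLE (by norm_num), 2),
    (fun _ => 4, (p.1 0).castSucc)] p.2

theorem swapMap_injective : swapMap.Injective := by
  decide

theorem swapMap_fst_eq_last :
    ∀ p, (swapMap p).1 0 = Fin.last 4 ↔ p.2 = Fin.last 2 := by
  decide

theorem swapMap_snd_eq_last :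
    ∀ p, (swapMap p).2 = Fin.last 2 ↔ ¬ p.2 = Fin.last 2 := by
  decide

theorem exists_swapMap_eq :
    ∀ t, (t.1 0 = Fin.last 4 ↔ ¬ t.2 = Fin.last 2) → ∃ p, swapMap p = t := by
  decide

/-- The output of the catalytic protocol: an even mixture of the flag for the system with a Bell
pair in the catalyst, and of the maximally entangled state for the system with the flag in the
catalyst. -/
theorem conjBy_swapMap : conjBy (relabel swapMap ⊗ₖ relabel swapMap)
      (bipTensor (copies bell 1) (flagged 2)) =
    (1 / 4 : ℂ) • schmidt (fun q : (Fin 1 → Fin 5) × Fin 3 =>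
        (if q.1 0 = Fin.last 4 then 1 else 0) * (if q.2 = Fin.last 2 then 0 else 1)) +
      (1 / 8 : ℂ) • schmidt (fun q : (Fin 1 → Fin 5) × Fin 3 =>
        (if q.1 0 = Fin.last 4 then 0 else 1) * (if q.2 = Fin.last 2 then 1 else 0)) := by
  rw [copies_bell, flagged, bipTensor_add, bipTensor_smul_smul, bipTensor_smul_smul,
    bipTensor_schmidt, bipTensor_schmidt, map_add, map_smul, map_smul]
  congr 2
  · norm_num
  · refine conjBy_relabel_schmidt swapMap_injective (fun p => ?_) fun t ht => ?_
    · rw [one_mul]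
      simp only [swapMap_fst_eq_last, swapMap_snd_eq_last]
      split_ifs <;> simp
    · refine exists_swapMap_eq t ?_
      by_contra h
      split_ifs at ht <;> simp_all
  · norm_num
  · refine conjBy_relabel_schmidt swapMap_injective (fun p => ?_) fun t ht => ?_
    · rw [one_mul]
      simp only [swapMap_fst_eq_last, swapMap_snd_eq_last]
      split_ifs <;> simp
    · refine exists_swapMap_eq t ?_
      by_contra h
      split_ifs at ht <;> simp_all

theorem one_mem_catalyticRates : (1 : ℝ) ∈ catalyticRates (flagged 4) := by
  intro δ hδ
  refine ⟨1, 1, 3, 3, flagged 2, conjBy (relabel swapMap ⊗ₖ relabel swapMap), one_pos,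
    flagged_isState (by norm_num), isLOCC_local_isometry (relabel_isometry swapMap_injective)
      (relabel_isometry swapMap_injective), ?_, ?_, by norm_num; exact hδ.le⟩
  · rw [conjBy_swapMap, copies_one_flagged, trCatalyst_add, trCatalyst_smul, trCatalyst_smul,
      trCatalyst_schmidt (fun a : Fin 1 → Fin 5 => if a 0 = Fin.last 4 then 1 else 0)
        (fun c : Fin 3 => if c = Fin.last 2 then 0 else 1),
      trCatalyst_schmidt (fun a : Fin 1 → Fin 5 => if a 0 = Fin.last 4 then 0 else 1)
        (fun c : Fin 3 => if c = Fin.last 2 then 1 else 0), smul_smul, smul_smul]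
    congr 2
    · rw [sum_ite_last_mul_star]
      norm_num
    · simp
      norm_num
  · rw [conjBy_swapMap, flagged, trSystem_add, trSystem_smul, trSystem_smul,
      trSystem_schmidt (fun a : Fin 1 → Fin 5 => if a 0 = Fin.last 4 then 1 else 0)
        (fun c : Fin 3 => if c = Fin.last 2 then 0 else 1),
      trSystem_schmidt (fun a : Fin 1 → Fin 5 => if a 0 = Fin.last 4 then 0 else 1)
        (fun c : Fin 3 => if c = Fin.last 2 then 1 else 0), smul_smul, smul_smul, add_comm]
    rw [← (Equiv.funUnique (Fin 1) (Fin 5)).symm.sum_comp,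
      ← (Equiv.funUnique (Fin 1) (Fin 5)).symm.sum_comp]
    congr 2
    · refine (congrArg _ (sum_ite_last_mul_star 4)).trans ?_
      norm_num
    · simp
      norm_num

end EntCost

theorem proposition3 :
    ∃ (dA dB : ℕ) (ρ : Matrix (Fin dA × Fin dB) (Fin dA × Fin dB) ℂ),
      EntCost.IsState ρ ∧
      (EntCost.exactRates ρ).Nonempty ∧ (EntCost.catalyticRates ρ).Nonempty ∧
      EntCost.catalyticExactCost ρ < EntCost.exactCost ρ := by
  refine ⟨5, 5, EntCost.flagged 4, EntCost.flagged_isState (by norm_num),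
    ⟨2, EntCost.two_mem_exactRates⟩, ⟨1, EntCost.one_mem_catalyticRates⟩, ?_⟩
  have hbdd : BddBelow (EntCost.catalyticRates (EntCost.flagged 4)) := by
    refine ⟨0, fun r hr => le_of_forall_pos_le_add fun δ hδ => ?_⟩
    obtain ⟨m, n, _, _, _, _, _, _, _, _, _, h⟩ := hr δ hδ
    exact le_trans (by positivity) h
  calc EntCost.catalyticExactCost (EntCost.flagged 4) ≤ 1 :=
        csInf_le hbdd EntCost.one_mem_catalyticRates
    _ < 2 := one_lt_two
    _ ≤ EntCost.exactCost (EntCost.flagged 4) :=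
        le_csInf ⟨2, EntCost.two_mem_exactRates⟩ fun _ => EntCost.two_le_of_mem_exactRates
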